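/- Let $R$ be a principal ideal domain of characteristic different from $2$, and let $\Delta\in R$ be a nonzero discriminant, i.e. $\Delta\neq 0$ and $\Delta=\pi^2+4n$ for some $\pi,n\in R$; fix such $\pi,n$. A binary quadratic form $[a,b,c]=ax^2+bxy+cy^2$ over $R$ is primitive if $\langle a,b,c\rangle=R$, and its discriminant is $b^2-4ac$. Two forms $q,q'$ are twisted-equivalent if $q'(x,y)=\frac{1}{\alpha\delta-\beta\gamma}\,q(\alpha x+\beta y,\gamma x+\delta y)$ for some $\begin{pmatrix}\alpha&\beta\\ \gamma&\delta\end{pmatrix}\in \mathrm{GL}_2(R)$. Let $\mathrm{Cl}^{tw}_R(\Delta)$ be the set of twisted-equivalence classes of primitive forms of discriminant $\Delta$. For a class $X$, let $H_X\subseteq (R/\Delta R)^\times$ be its set of values, that is, the set of all units of $R/\Delta R$ of the form $q(x,y)$ with $q\in X$ and $x,y\in R/\Delta R$. Let $H_0$ be the set of values of the class of the principal form $[1,\pi,-n]$, where $n=\frac{\Delta-\pi^2}{4}$; it is a subgroup of $(R/\Delta R)^\times$. There is exactly one commutative group structure on $\mathrm{Cl}^{tw}_R(\Delta)$ for which there is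 a group isomorphism $$\mathrm{Cl}^{tw}_R(\Delta)\;\cong\;\mathrm{Pic}\big(R[\omega]/\langle \omega^2+\pi\omega-n\rangle\big)$$ sending the class of each form $[a,b,c]$ with $a\neq 0$ to the class of the ideal $\langle \omega+\tfrac{\pi-b}{2},\,a\rangle$ (in particular $\frac{\pi-b}{2}\in R$); its neutral element is the class of $[1,\pi,-n]$. For this group structure, the following holds. Each $H_X$ is a coset of $H_0$ in $(R/\Delta R)^\times$, so that the map $$\psi\colon \mathrm{Cl}^{tw}_R(\Delta)\longrightarrow (R/\Delta R)^\times/H_0,\qquad X\longmapsto H_X,$$ is well defined, and $\psi$ is a group homomorphism. The kernel of $\psi$ contains the subgroup $\mathrm{Cl}^{tw}_R(\Delta)^{\square}$ of squares; hence $\psi$ factors, through a unique group homomorphism $$\Psi\colon \mathrm{Cl}^{tw}_R(\Delta)/\mathrm{Cl}^{tw}_R(\Delta)^{\square}\longrightarrow (R/\Delta R)^\times/H_0 ,$$ called the Genus map. -/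

import Mathlib

/-- The binary quadratic form `[a, b, c] = a x² + b x y + c y²` with coefficients in `R`. -/
@[ext]
structure BinForm (R : Type*) where
  a : R
  b : R
  c : R

namespace BinForm

variable {R : Type*} [CommRing R]

/-- The value `q(x, y)` at elements `x, y` of an `R`-algebra. -/
def eval (q : BinForm R) {A : Type*} [CommRing A] [Algebra R A] (x y : A) : A :=
  algebraMap R A q.a * x ^ 2 + algebraMap R A q.b * (x * y) + algebraMap R A q.c * y ^ 2

/-- The discriminant `b² - 4ac`. -/
def disc (q : BinForm R) : R := q.b ^ 2 - 4 * q.a * q.c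

/-- `q` is primitive if its coefficients generate the unit ideal. -/
def IsPrimitive (q : BinForm R) : Prop := Ideal.span {q.a, q.b, q.c} = ⊤

/-- The twisted action of `GL₂(R)`: the coefficients of the form
`det(M)⁻¹ q(αx + βy, γx + δy)`, where `M = (α β; γ δ)`; see `BinForm.eval_twist`. -/
def twist (M : GL (Fin 2) R) (q : BinForm R) : BinForm R where
  a := (M.det⁻¹ : Rˣ) * (q.a * M 0 0 ^ 2 + q.b * (M 0 0 * M 1 0) + q.c * M 1 0 ^ 2)
  b := (M.det⁻¹ : Rˣ) * (q.b * (M 0 0 * M 1 1 + M 0 1 * M 1 0)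
        + 2 * (q.a * M 0 0 * M 0 1 + q.c * M 1 0 * M 1 1))
  c := (M.det⁻¹ : Rˣ) * (q.a * M 0 1 ^ 2 + q.b * (M 0 1 * M 1 1) + q.c * M 1 1 ^ 2)

theorem eval_twist (M : GL (Fin 2) R) (q : BinForm R) (x y : R) :
    (twist M q).eval x y =
      (M.det⁻¹ : Rˣ) * q.eval (M 0 0 * x + M 0 1 * y) (M 1 0 * x + M 1 1 * y) := by
  simp only [eval, twist, Algebra.algebraMap_self, RingHom.id_apply]
  ring

theorem det_inv_mul (M : GL (Fin 2) R) :
    ((M.det⁻¹ : Rˣ) : R) * (M 0 0 * M 1 1 - M 0 1 * M 1 0) = 1 := by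
  rw [← Matrix.det_fin_two, ← Matrix.GeneralLinearGroup.val_det_apply, Units.inv_mul]

theorem disc_twist (M : GL (Fin 2) R) (q : BinForm R) : (twist M q).disc = q.disc := by
  have h := det_inv_mul M
  simp only [disc, twist]
  linear_combination (q.b ^ 2 - 4 * q.a * q.c) *
    (((M.det⁻¹ : Rˣ) : R) * (M 0 0 * M 1 1 - M 0 1 * M 1 0) + 1) * h

theorem twist_one (q : BinForm R) : twist 1 q = q := by
  ext <;> simp [twist]

theorem twist_twist (M N : GL (Fin 2) R) (q : BinForm R) :
    twist N (twist M q) = twist (M * N) q := by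
  ext <;> simp only [twist, map_mul, mul_inv, Units.val_mul, Matrix.mul_apply,
    Fin.sum_univ_two] <;> ring

theorem span_twist_le (M : GL (Fin 2) R) (q : BinForm R) :
    Ideal.span {(twist M q).a, (twist M q).b, (twist M q).c} ≤ Ideal.span {q.a, q.b, q.c} := by
  have ha : q.a ∈ Ideal.span {q.a, q.b, q.c} := Ideal.subset_span (by simp)
  have hb : q.b ∈ Ideal.span {q.a, q.b, q.c} := Ideal.subset_span (by simp)
  have hc : q.c ∈ Ideal.span {q.a, q.b, q.c} := Ideal.subset_span (by simp)
  generalize Ideal.span {q.a, q.b, q.c} = I at *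
  have key : ∀ r s t : R, r * q.a + s * q.b + t * q.c ∈ I := fun r s t =>
    I.add_mem (I.add_mem (I.mul_mem_left _ ha) (I.mul_mem_left _ hb)) (I.mul_mem_left _ hc)
  rw [Ideal.span_le]
  rintro z (rfl | rfl | rfl)
  · refine SetLike.mem_coe.mpr ?_
    convert key ((M.det⁻¹ : Rˣ) * M 0 0 ^ 2) ((M.det⁻¹ : Rˣ) * (M 0 0 * M 1 0))
      ((M.det⁻¹ : Rˣ) * M 1 0 ^ 2) using 1
    simp only [twist]; ring
  · refine SetLike.mem_coe.mpr ?_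
    convert key ((M.det⁻¹ : Rˣ) * (2 * M 0 0 * M 0 1))
      ((M.det⁻¹ : Rˣ) * (M 0 0 * M 1 1 + M 0 1 * M 1 0))
      ((M.det⁻¹ : Rˣ) * (2 * M 1 0 * M 1 1)) using 1
    simp only [twist]; ring
  · refine SetLike.mem_coe.mpr ?_
    convert key ((M.det⁻¹ : Rˣ) * M 0 1 ^ 2) ((M.det⁻¹ : Rˣ) * (M 0 1 * M 1 1))
      ((M.det⁻¹ : Rˣ) * M 1 1 ^ 2) using 1
    simp only [twist]; ring

theorem isPrimitive_twist (M : GL (Fin 2) R) {q : BinForm R} (hq : q.IsPrimitive) :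
    (twist M q).IsPrimitive := by
  have h := span_twist_le M⁻¹ (twist M q)
  rw [twist_twist, mul_inv_cancel, twist_one] at h
  exact top_le_iff.mp ((le_of_eq hq.symm).trans h)

end BinForm

/-- Primitive binary quadratic forms over `R` of discriminant `Δ`. -/
def PrimForm (R : Type*) [CommRing R] (Δ : R) : Type _ :=
  {q : BinForm R // q.IsPrimitive ∧ q.disc = Δ}

/-- Twisted equivalence: `q ~ q'` if `q' = M · q` for some `M ∈ GL₂(R)`. -/
instance PrimForm.setoid (R : Type*) [CommRing R] (Δ : R) : Setoid (PrimForm R Δ) where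
  r q q' := ∃ M : GL (Fin 2) R, q'.1 = BinForm.twist M q.1
  iseqv :=
    { refl := fun q => ⟨1, (BinForm.twist_one q.1).symm⟩
      symm := by
        rintro q q' ⟨M, h⟩
        exact ⟨M⁻¹, by rw [h, BinForm.twist_twist, mul_inv_cancel, BinForm.twist_one]⟩
      trans := by
        rintro q q' q'' ⟨M, h⟩ ⟨N, h'⟩
        exact ⟨M * N, by rw [h', h, BinForm.twist_twist]⟩ }

/-- The set `Cl^tw_R(Δ)` of twisted equivalence classes of primitive forms of discriminant `Δ`. -/
def TwistedClass (R : Type*) [CommRing R] (Δ : R) : Type _ :=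
  Quotient (PrimForm.setoid R Δ)

/-- The twisted equivalence class of a primitive form. -/
def PrimForm.toClass {R : Type*} [CommRing R] {Δ : R} (q : PrimForm R Δ) : TwistedClass R Δ :=
  Quotient.mk (PrimForm.setoid R Δ) q

section Values

variable {R : Type*} [CommRing R] {Δ : R}

/-- The set of values of the form `q` in `(R/Δ)ˣ`. -/
def PrimForm.values (q : PrimForm R Δ) : Set (R ⧸ Ideal.span {Δ})ˣ :=
  {u | ∃ x y : R ⧸ Ideal.span {Δ}, (u : R ⧸ Ideal.span {Δ}) = q.1.eval x y}

/-- The set of values `H_q` in `(R/Δ)ˣ` of a class of forms: the union of the sets of values of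
the forms in the class. -/
def TwistedClass.values (X : TwistedClass R Δ) : Set (R ⧸ Ideal.span {Δ})ˣ :=
  ⋃ (q : PrimForm R Δ) (_ : q.toClass = X), q.values

/-- The principal form `[1, π, -n]`, where `Δ = π² + 4n`, that is `n = (Δ - π²)/4`. -/
def principalForm (π n : R) (h : Δ = π ^ 2 + 4 * n) : PrimForm R Δ :=
  ⟨⟨1, π, -n⟩, (Ideal.eq_top_iff_one _).mpr (Ideal.subset_span (by simp)), by
    simp only [BinForm.disc, h]; ring⟩

/-- Elements of `H_q` are the values of `q` up to units of `R`. -/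
theorem PrimForm.mem_values_toClass (q : PrimForm R Δ) (u : (R ⧸ Ideal.span {Δ})ˣ) :
    u ∈ q.toClass.values ↔ ∃ (e : Rˣ) (x y : R ⧸ Ideal.span {Δ}),
      (u : R ⧸ Ideal.span {Δ}) = algebraMap R (R ⧸ Ideal.span {Δ}) e * q.1.eval x y := by
  simp only [TwistedClass.values, Set.mem_iUnion, PrimForm.values, Set.mem_ofPred_eq, exists_prop]
  constructor
  · rintro ⟨q', hq', x, y, hu⟩
    obtain ⟨M, hM⟩ := Quotient.exact hq'.symm
    refine ⟨M.det⁻¹, algebraMap R _ (M 0 0) * x + algebraMap R _ (M 0 1) * y,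
      algebraMap R _ (M 1 0) * x + algebraMap R _ (M 1 1) * y, ?_⟩
    rw [hu, hM]
    simp only [BinForm.eval, BinForm.twist, map_mul, map_add, map_pow, map_ofNat]
    ring
  · rintro ⟨e, x, y, hu⟩
    let M : GL (Fin 2) R :=
      ⟨!![1, 0; 0, ((e⁻¹ : Rˣ) : R)], !![1, 0; 0, (e : R)],
        by ext i j; fin_cases i <;> fin_cases j <;> simp,
        by ext i j; fin_cases i <;> fin_cases j <;> simp⟩
    have hdet : M.det = e⁻¹ := by
      ext; simp [M, Matrix.det_fin_two]
    refine ⟨⟨BinForm.twist M q.1, BinForm.isPrimitive_twist M q.2.1,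
      (BinForm.disc_twist M q.1).trans q.2.2⟩, (Quotient.sound ⟨M, rfl⟩ : q.toClass = _).symm,
      x, algebraMap R _ (e : R) * y, ?_⟩
    have he : algebraMap R (R ⧸ Ideal.span {Δ}) ((e⁻¹ : Rˣ) : R) *
        algebraMap R (R ⧸ Ideal.span {Δ}) (e : R) = 1 := by
      rw [← map_mul, Units.inv_mul, map_one]
    have hM : M 0 0 = 1 ∧ M 0 1 = 0 ∧ M 1 0 = 0 ∧ M 1 1 = ((e⁻¹ : Rˣ) : R) := by
      simp [M]
    obtain ⟨h00, h01, h10, h11⟩ := hM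
    rw [hu]
    simp only [BinForm.eval, BinForm.twist, hdet, h00, h01, h10, h11, inv_inv, map_mul, map_add,
      map_pow, map_zero, map_one, map_ofNat]
    generalize algebraMap R (R ⧸ Ideal.span {Δ}) ((e⁻¹ : Rˣ) : R) = f at *
    generalize algebraMap R (R ⧸ Ideal.span {Δ}) (e : R) = g at *
    generalize algebraMap R (R ⧸ Ideal.span {Δ}) q.1.b = b
    generalize algebraMap R (R ⧸ Ideal.span {Δ}) q.1.c = c
    linear_combination (-(g * b * x * y) - g * c * y ^ 2 * (f * g + 1)) * he

/-- The subgroup `H₀` of `(R/Δ)ˣ`: its elements are the values of the principal form class. -/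
def principalValues (π n : R) (h : Δ = π ^ 2 + 4 * n) : Subgroup (R ⧸ Ideal.span {Δ})ˣ where
  carrier := (principalForm π n h).toClass.values
  one_mem' := by
    rw [PrimForm.mem_values_toClass]
    exact ⟨1, 1, 0, by simp [BinForm.eval, principalForm]⟩
  mul_mem' := by
    intro u v hu hv
    rw [PrimForm.mem_values_toClass] at *
    obtain ⟨e, x, y, hu⟩ := hu
    obtain ⟨f, z, w, hv⟩ := hv
    refine ⟨e * f, x * z + algebraMap R _ n * (y * w),
      x * w + z * y + algebraMap R _ π * (y * w), ?_⟩
    rw [Units.val_mul, hu, hv]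
    simp only [BinForm.eval, principalForm, Units.val_mul, map_mul, map_one, map_neg]
    ring
  inv_mem' := by
    intro u hu
    rw [PrimForm.mem_values_toClass] at *
    obtain ⟨e, x, y, hu⟩ := hu
    have he : algebraMap R (R ⧸ Ideal.span {Δ}) ((e⁻¹ : Rˣ) : R) *
        algebraMap R (R ⧸ Ideal.span {Δ}) (e : R) = 1 := by
      rw [← map_mul, Units.inv_mul, map_one]
    have hw : (u : R ⧸ Ideal.span {Δ}) * ((u⁻¹ : (R ⧸ Ideal.span {Δ})ˣ) : R ⧸ Ideal.span {Δ})
        = 1 := u.mul_inv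
    refine ⟨e, x * ((u⁻¹ : (R ⧸ Ideal.span {Δ})ˣ) : R ⧸ Ideal.span {Δ}),
      y * ((u⁻¹ : (R ⧸ Ideal.span {Δ})ˣ) : R ⧸ Ideal.span {Δ}), ?_⟩
    generalize ((u⁻¹ : (R ⧸ Ideal.span {Δ})ˣ) : R ⧸ Ideal.span {Δ}) = w at *
    simp only [BinForm.eval] at *
    linear_combination -w * hw + w ^ 2 * hu

end Values

section Composition

variable {R : Type*} [CommRing R]

/-- `R[ω]/(ω² + πω - n)`. When `Δ = π² + 4n` this is the quadratic algebra of discriminant `Δ`. -/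
abbrev QuadAlg (π n : R) : Type _ := QuadraticAlgebra R n (-π)

/-- A commutative group structure on `Cl^tw_R(Δ)` is the composition law if it is transported from
`Pic(R[ω]/(ω² + πω - n))` by the bijection which sends the class of a form `[a, b, c]` with `a ≠ 0`
to the class of the ideal `⟨ω + (π - b)/2, a⟩`. -/
def IsCompositionLaw {Δ : R} (π n : R) (G : CommGroup (TwistedClass R Δ)) : Prop :=
  ∃ Φ : TwistedClass R Δ ≃* CommRing.Pic (QuadAlg π n),
    ∀ q : PrimForm R Δ, q.1.a ≠ 0 →
      ∃ t : R, 2 * t = π - q.1.b ∧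
        Nonempty ((Φ q.toClass).AsModule ≃ₗ[QuadAlg π n]
          (Ideal.span {QuadraticAlgebra.omega + algebraMap R (QuadAlg π n) t,
            algebraMap R (QuadAlg π n) q.1.a} : Ideal (QuadAlg π n)))

end Composition

/-! Write `S = R[ω]`. A form `[a, b, c]` of discriminant `Δ` records, through `t = (π - b)/2`, how
`ω` acts on an `R`-basis of an `S`-module, and twisted equivalence is change of basis
(`IsModel.twist`, `IsModel.exists_twist_eq`). Twisted classes and isomorphism classes of modules
thus determine each other. A form with `a ≠ 0` has the module `⟨ω + t, a⟩`, which is invertible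
because by primitivity its product with `⟨ω + π - t, a⟩` is `⟨a⟩` (`QuadAlg.pairIdeal_mul_conj`).
Conversely an invertible `S`-module is free of rank 2 over `R`, and the form read off from `ω` is
primitive because every endomorphism commuting with `ω` lies in `S` (`QuadAlg.exists_isModel`). The
resulting bijection with `Pic S` is the only one compatible with the ideals, so it transports
exactly one group law.

For the genus map, each class has a form with `a` coprime to `Δ`. The identity `a q(x, y) = q₀(a x -
t y, y)`, together with `q₀(u, 0) = u²`, shows that its value set is the coset `a H₀`. Two classes
have concordant representatives `[a₁, b, a₂c]` and `[a₂, b, a₁c]`, whose product is the class of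
`[a₁a₂, b, c]`; hence `ψ` is multiplicative. It kills squares because `H₀` contains all squares. -/

namespace BinForm

/-! ### Values and coefficients of primitive forms. -/

variable {R : Type*} [CommRing R]

theorem exists_gl_eq {a b c d : R} (h : IsUnit (a * d - b * c)) :
    ∃ M : GL (Fin 2) R, M 0 0 = a ∧ M 0 1 = b ∧ M 1 0 = c ∧ M 1 1 = d := by
  rw [← Matrix.det_fin_two_of] at h
  exact ⟨Matrix.nonsingInvUnit _ h, by simp [Matrix.nonsingInvUnit]⟩

theorem det_inv_eq_one {M : GL (Fin 2) R} (h : M 0 0 * M 1 1 - M 0 1 * M 1 0 = 1) :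
    ((M.det⁻¹ : Rˣ) : R) = 1 := by
  simpa [h] using det_inv_mul M

theorem exists_twist_a_eq (q : BinForm R) {x y : R} (h : IsCoprime x y) :
    ∃ M : GL (Fin 2) R, (twist M q).a = q.a * x ^ 2 + q.b * (x * y) + q.c * y ^ 2 := by
  obtain ⟨u, w, huw⟩ := h
  obtain ⟨M, h₁, h₂, h₃, h₄⟩ := exists_gl_eq (a := x) (b := -w) (c := y) (d := u)
    ((by linear_combination huw : x * u - -w * y = 1) ▸ isUnit_one)
  refine ⟨M, ?_⟩
  simp only [twist]
  rw [det_inv_eq_one (by rw [h₁, h₂, h₃, h₄]; linear_combination huw), h₁, h₃, one_mul]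

/-- The translate `q(x + k y, y)`. -/
theorem exists_twist_translate (q : BinForm R) (k : R) :
    ∃ M : GL (Fin 2) R,
      twist M q = ⟨q.a, q.b + 2 * (q.a * k), q.a * k ^ 2 + q.b * k + q.c⟩ := by
  obtain ⟨M, h₁, h₂, h₃, h₄⟩ := exists_gl_eq (a := (1 : R)) (b := k) (c := 0) (d := 1) (by simp)
  refine ⟨M, ?_⟩
  simp only [twist]
  rw [det_inv_eq_one (by rw [h₁, h₂, h₃, h₄]; ring), h₁, h₂, h₃, h₄]
  ext <;> ring

theorem isPrimitive_iff (q : BinForm R) :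
    q.IsPrimitive ↔ ∃ r s t : R, r * q.a + s * q.b + t * q.c = 1 := by
  rw [IsPrimitive, Ideal.eq_top_iff_one, Ideal.mem_span_insert]
  constructor
  · rintro ⟨r, z, hz, h⟩
    obtain ⟨s, t, rfl⟩ := Ideal.mem_span_pair.mp hz
    exact ⟨r, s, t, by rw [h]; ring⟩
  · rintro ⟨r, s, t, h⟩
    exact ⟨r, s * q.b + t * q.c, Ideal.mem_span_pair.mpr ⟨s, t, rfl⟩, by rw [← h]; ring⟩

theorem IsPrimitive.isUnit_of_dvd {q : BinForm R} (hq : q.IsPrimitive) {p : R}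
    (ha : p ∣ q.a) (hb : p ∣ q.b) (hc : p ∣ q.c) : IsUnit p := by
  obtain ⟨r, s, t, h⟩ := q.isPrimitive_iff.mp hq
  exact isUnit_of_dvd_one (h ▸ dvd_add (dvd_add (ha.mul_left r) (hb.mul_left s)) (hc.mul_left t))

variable [IsDomain R]

theorem IsPrimitive.exists_value_ne_zero {q : BinForm R} (hq : q.IsPrimitive) :
    ∃ x y : R, IsCoprime x y ∧ q.a * x ^ 2 + q.b * (x * y) + q.c * y ^ 2 ≠ 0 := by
  by_cases ha : q.a = 0
  · by_cases hc : q.c = 0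
    · refine ⟨1, 1, isCoprime_one_left, fun h => ?_⟩
      have hb : q.b = 0 := by simpa [ha, hc] using h
      exact not_isUnit_zero (hq.isUnit_of_dvd (by simp [ha]) (by simp [hb]) (by simp [hc]))
    · exact ⟨0, 1, isCoprime_one_right, by simpa using hc⟩
  · exact ⟨1, 0, isCoprime_one_left, by simpa using ha⟩

variable [IsPrincipalIdealRing R]

open UniqueFactorizationMonoid in
/-- A primitive form represents primitively a value coprime to a given nonzero element. -/
theorem IsPrimitive.exists_isCoprime_value {q : BinForm R} (hq : q.IsPrimitive) {N : R}
    (hN : N ≠ 0) : ∃ x y : R, IsCoprime x y ∧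
      q.a * x ^ 2 + q.b * (x * y) + q.c * y ^ 2 ≠ 0 ∧
      IsCoprime (q.a * x ^ 2 + q.b * (x * y) + q.c * y ^ 2) N := by
  classical
  by_cases hu : IsUnit N
  · obtain ⟨x, y, h, h'⟩ := hq.exists_value_ne_zero
    exact ⟨x, y, h, h', isCoprime_one_right.of_isCoprime_of_dvd_right hu.dvd⟩
  -- Modulo a prime `p ∣ N` the value at `(X, Y)` becomes `a X²` if `p ∤ a`, `c Y²` if `p ∣ a` and
  -- `p ∤ c`, and `b X Y` if `p` divides both; no surviving factor is divisible by `p`.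
  set X : R := ((factors N).filter fun p => p ∣ q.a ∧ ¬ p ∣ q.c).prod with hX
  set Y : R := ((factors N).filter fun p => ¬ p ∣ q.a).prod with hY
  have key : ∀ {P : R → Prop} [DecidablePred P], (∀ p p', Associated p p' → P p' → P p) →
      ∀ {p : R}, Prime p → p ∣ N → (p ∣ ((factors N).filter P).prod ↔ P p) := by
    intro P _ hP p hp hpN
    constructor
    · intro h
      obtain ⟨r, hr, hpr⟩ := hp.exists_mem_multiset_dvd h
      rw [Multiset.mem_filter] at hr
      exact hP p r (hp.associated_of_dvd (prime_of_factor r hr.1) hpr) hr.2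
    · intro h
      obtain ⟨r, hr, hpr⟩ := exists_mem_factors_of_dvd hN hp.irreducible hpN
      exact hpr.dvd.trans (Multiset.dvd_prod (Multiset.mem_filter.mpr ⟨hr, hP r p hpr.symm h⟩))
  have hXp : ∀ {p : R}, Prime p → p ∣ N → (p ∣ X ↔ p ∣ q.a ∧ ¬ p ∣ q.c) :=
    key fun p p' h => by rw [h.dvd_iff_dvd_left, h.dvd_iff_dvd_left]; exact id
  have hYp : ∀ {p : R}, Prime p → p ∣ N → (p ∣ Y ↔ ¬ p ∣ q.a) :=
    key fun p p' h => by rw [h.dvd_iff_dvd_left]; exact id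
  have hXN : X ∣ N := (Multiset.prod_dvd_prod_of_le (Multiset.filter_le _ _)).trans
    (factors_prod hN).dvd
  have hX0 : X ≠ 0 := ne_zero_of_dvd_ne_zero hN hXN
  have hcop : IsCoprime (q.a * X ^ 2 + q.b * (X * Y) + q.c * Y ^ 2) N := by
    refine isCoprime_of_prime_dvd (fun h => hN h.2) fun p hp hpv hpN => ?_
    by_cases ha : p ∣ q.a
    · have hY' : ¬ p ∣ Y := fun h => (hYp hp hpN).mp h ha
      by_cases hc : p ∣ q.c
      · have hX' : ¬ p ∣ X := fun h => ((hXp hp hpN).mp h).2 hc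
        have h1 : p ∣ q.b * (X * Y) := by
          have := (hpv.sub (ha.mul_right (X ^ 2))).sub (hc.mul_right (Y ^ 2))
          ring_nf at this ⊢
          exact this
        rcases hp.dvd_or_dvd h1 with hb | h2
        · exact hp.not_isUnit (hq.isUnit_of_dvd ha hb hc)
        · exact (hp.dvd_or_dvd h2).elim hX' hY'
      · have hX' : p ∣ X := (hXp hp hpN).mpr ⟨ha, hc⟩
        have h1 : p ∣ q.c * Y ^ 2 := by
          have := hpv.sub (hX'.mul_right (q.a * X + q.b * Y))
          ring_nf at this ⊢
          exact this
        exact (hp.dvd_or_dvd h1).elim hc fun h => hY' (hp.dvd_of_dvd_pow h)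
    · have hY' : p ∣ Y := (hYp hp hpN).mpr ha
      have hX' : ¬ p ∣ X := fun h => ha ((hXp hp hpN).mp h).1
      have h1 : p ∣ q.a * X ^ 2 := by
        have := hpv.sub (hY'.mul_right (q.b * X + q.c * Y))
        ring_nf at this ⊢
        exact this
      exact (hp.dvd_or_dvd h1).elim ha fun h => hX' (hp.dvd_of_dvd_pow h)
  refine ⟨X, Y, isCoprime_of_prime_dvd (fun h => hX0 h.1) fun p hp h1 h2 => ?_, fun h => ?_, hcop⟩
  · have hpN := h1.trans hXN
    exact (hYp hp hpN).mp h2 ((hXp hp hpN).mp h1).1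
  · rw [h, isCoprime_zero_left] at hcop
    exact hu hcop

/-- If `b² - 4ac = π² + 4n`, then `(π - b)/2` lies in `R`, as it is integral over `R`. -/
theorem exists_two_mul_eq_sub (h2 : (2 : R) ≠ 0) (q : BinForm R) {π n : R}
    (h : q.disc = π ^ 2 + 4 * n) : ∃ t : R, 2 * t = π - q.b := by
  let K := FractionRing R
  have h2K : (2 : K) ≠ 0 := by
    rw [← map_ofNat (algebraMap R K)]
    exact (map_ne_zero_iff _ (IsFractionRing.injective R K)).mpr h2
  have hx : 2 * (algebraMap R K (π - q.b) / 2) = algebraMap R K (π - q.b) := mul_div_cancel₀ _ h2K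
  have hint : IsIntegral R (algebraMap R K (π - q.b) / 2) := by
    -- For `x = (π - b)/2`, `x (x + b) = (π² - b²)/4 = -(ac + n)`.
    refine ⟨.X ^ 2 + (.C q.b * .X + .C (q.a * q.c + n)), by monicity!, ?_⟩
    generalize algebraMap R K (π - q.b) / 2 = x at *
    have h' := congrArg (algebraMap R K) h
    simp only [disc, map_sub, map_add, map_mul, map_pow, map_ofNat] at h' hx
    simp only [Polynomial.eval₂_add, Polynomial.eval₂_pow, Polynomial.eval₂_X,
      Polynomial.eval₂_mul, Polynomial.eval₂_C, map_add, map_mul]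
    refine mul_left_cancel₀ h2K (mul_left_cancel₀ h2K ?_)
    linear_combination (2 * x + algebraMap R K π + algebraMap R K q.b) * hx - h'
  obtain ⟨t, ht⟩ := IsIntegrallyClosed.isIntegral_iff.mp hint
  refine ⟨t, IsFractionRing.injective R K ?_⟩
  rw [map_mul, ht, map_ofNat, hx]

-- The right-hand side is the norm of `ω + t`, the form in which the discriminant enters all ideal
-- computations.
omit [IsPrincipalIdealRing R] in
theorem mul_eq_of_disc_eq (h2 : (2 : R) ≠ 0) (q : BinForm R) {π n t : R}
    (h : q.disc = π ^ 2 + 4 * n) (ht : 2 * t = π - q.b) : q.a * q.c = t ^ 2 - π * t - n := by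
  refine mul_left_cancel₀ h2 (mul_left_cancel₀ h2 ?_)
  rw [disc] at h
  linear_combination -h - (2 * t - π - q.b) * ht

end BinForm

/-! ### Good representatives and concordant forms. -/

namespace TwistedClass

variable {R : Type*} [CommRing R] [IsDomain R] [IsPrincipalIdealRing R] {Δ : R}

omit [IsDomain R] [IsPrincipalIdealRing R] in
theorem toClass_eq_toClass {q q' : PrimForm R Δ} :
    q.toClass = q'.toClass ↔ ∃ M : GL (Fin 2) R, q'.1 = BinForm.twist M q.1 :=
  ⟨fun h => Quotient.exact h, fun h => Quotient.sound h⟩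

/-- Each class contains a form whose first coefficient is nonzero and coprime to `N`. -/
theorem exists_rep_isCoprime (X : TwistedClass R Δ) {N : R} (hN : N ≠ 0) :
    ∃ q : PrimForm R Δ, q.toClass = X ∧ q.1.a ≠ 0 ∧ IsCoprime q.1.a N := by
  induction X using Quotient.inductionOn with | _ q =>
  obtain ⟨x, y, hxy, h0, hN⟩ := q.2.1.exists_isCoprime_value hN
  obtain ⟨M, hM⟩ := q.1.exists_twist_a_eq hxy
  refine ⟨⟨BinForm.twist M q.1, BinForm.isPrimitive_twist M q.2.1,
    (BinForm.disc_twist M q.1).trans q.2.2⟩, (toClass_eq_toClass.mpr ⟨M, rfl⟩ : q.toClass = _).symm,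
    by rwa [hM], by rwa [hM]⟩

/-- Dirichlet's concordant forms. -/
theorem exists_concordant (h2 : (2 : R) ≠ 0) (hΔ : Δ ≠ 0) {π n : R} (hπ : Δ = π ^ 2 + 4 * n)
    (X Y : TwistedClass R Δ) :
    ∃ (q₁ q₂ : PrimForm R Δ) (a₁ a₂ b c : R), q₁.toClass = X ∧ q₂.toClass = Y ∧
      q₁.1 = ⟨a₁, b, a₂ * c⟩ ∧ q₂.1 = ⟨a₂, b, a₁ * c⟩ ∧
      a₁ ≠ 0 ∧ a₂ ≠ 0 ∧ IsCoprime a₁ a₂ ∧ IsCoprime a₁ Δ ∧ IsCoprime a₂ Δ := by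
  obtain ⟨q₁, hX, h₁, h₁Δ⟩ := X.exists_rep_isCoprime hΔ
  obtain ⟨q₂, hY, h₂, h₂Δ⟩ := Y.exists_rep_isCoprime (mul_ne_zero hΔ h₁)
  obtain ⟨t₁, ht₁⟩ := q₁.1.exists_two_mul_eq_sub h2 (q₁.2.2.trans hπ)
  obtain ⟨t₂, ht₂⟩ := q₂.1.exists_two_mul_eq_sub h2 (q₂.2.2.trans hπ)
  have h₁₂ : IsCoprime q₁.1.a q₂.1.a := h₂Δ.of_mul_right_right.symm
  obtain ⟨u, v, huv⟩ := h₁₂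
  -- Translation by `k` replaces `t` by `t - a k`. With `u a₁ + v a₂ = 1` these two translations
  -- make `t₁` and `t₂` equal.
  obtain ⟨M₁, hM₁⟩ := q₁.1.exists_twist_translate (u * (t₁ - t₂))
  obtain ⟨M₂, hM₂⟩ := q₂.1.exists_twist_translate (v * (t₂ - t₁))
  let p₁ : PrimForm R Δ := ⟨BinForm.twist M₁ q₁.1, BinForm.isPrimitive_twist M₁ q₁.2.1,
    (BinForm.disc_twist M₁ q₁.1).trans q₁.2.2⟩
  let p₂ : PrimForm R Δ := ⟨BinForm.twist M₂ q₂.1, BinForm.isPrimitive_twist M₂ q₂.2.1,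
    (BinForm.disc_twist M₂ q₂.1).trans q₂.2.2⟩
  have hp₁ : p₁.1 = _ := hM₁
  have hp₂ : p₂.1 = _ := hM₂
  have hb : p₁.1.b = p₂.1.b := by
    rw [hp₁, hp₂]
    linear_combination ht₁ - ht₂ + 2 * (t₁ - t₂) * huv
  have ha₁ : p₁.1.a = q₁.1.a := by rw [hp₁]
  have ha₂ : p₂.1.a = q₂.1.a := by rw [hp₂]
  have hac : p₁.1.a * p₁.1.c = p₂.1.a * p₂.1.c := by
    have h := p₁.2.2.trans p₂.2.2.symm
    refine mul_left_cancel₀ h2 (mul_left_cancel₀ h2 ?_)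
    simp only [BinForm.disc, hb] at h
    linear_combination -h
  have hcop : IsCoprime p₁.1.a p₂.1.a := by rw [ha₁, ha₂]; exact ⟨u, v, huv⟩
  obtain ⟨c, hc⟩ : p₂.1.a ∣ p₁.1.c := hcop.symm.dvd_of_dvd_mul_left ⟨_, hac⟩
  have hc₂ : p₂.1.c = p₁.1.a * c := by
    refine mul_left_cancel₀ (a := p₂.1.a) (by rwa [ha₂]) ?_
    rw [← hac, hc]; ring
  refine ⟨p₁, p₂, p₁.1.a, p₂.1.a, p₁.1.b, c, hX ▸ (toClass_eq_toClass.mpr ⟨M₁, rfl⟩).symm,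
    hY ▸ (toClass_eq_toClass.mpr ⟨M₂, rfl⟩).symm, ?_, ?_, ha₁ ▸ h₁, ha₂ ▸ h₂, hcop, ha₁ ▸ h₁Δ,
    ha₂ ▸ h₂Δ.of_mul_right_left⟩
  · rw [← hc]
  · rw [← hc₂, hb]

end TwistedClass

/-! ### Value sets as cosets of `H₀`. -/

section ValuesCoset

variable {R : Type*} [CommRing R] {Δ : R}

theorem sq_mem_principalValues {π n : R} (hπ : Δ = π ^ 2 + 4 * n) (u : (R ⧸ Ideal.span {Δ})ˣ) :
    u ^ 2 ∈ principalValues π n hπ := by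
  refine (PrimForm.mem_values_toClass _ _).mpr ⟨1, u, 0, ?_⟩
  simp [BinForm.eval, principalForm]

/-- `a q(x, y) = q₀(a x - t y, y)`, where `q₀ = [1, π, -n]` and `t = (π - b)/2`. -/
theorem BinForm.a_mul_eval (q : BinForm R) {π n t : R} (ht : 2 * t = π - q.b)
    (hac : q.a * q.c = t ^ 2 - π * t - n) {A : Type*} [CommRing A] [Algebra R A] (x y : A) :
    algebraMap R A q.a * q.eval x y =
      (⟨1, π, -n⟩ : BinForm R).eval (algebraMap R A q.a * x - algebraMap R A t * y) y := by
  have h₁ := congrArg (algebraMap R A) ht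
  have h₂ := congrArg (algebraMap R A) hac
  simp only [BinForm.eval, map_one, map_neg, map_mul, map_sub, map_pow, map_ofNat] at *
  linear_combination y ^ 2 * h₂ + algebraMap R A q.a * x * y * h₁

/-- As `a` is invertible modulo `Δ`, `(x, y) ↦ (a x - t y, y)` is bijective, so `BinForm.a_mul_eval`
gives `u H_q = H₀`. Since `u² ∈ H₀`, the cosets of `u` and `u⁻¹` coincide. -/
theorem PrimForm.values_toClass_eq_preimage {π n : R} (hπ : Δ = π ^ 2 + 4 * n) (q : PrimForm R Δ)
    {t : R} (ht : 2 * t = π - q.1.b) (hac : q.1.a * q.1.c = t ^ 2 - π * t - n)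
    (u : (R ⧸ Ideal.span {Δ})ˣ) (hu : (u : R ⧸ Ideal.span {Δ}) = algebraMap R _ q.1.a) :
    (QuotientGroup.mk : _ → (R ⧸ Ideal.span {Δ})ˣ ⧸ principalValues π n hπ) ⁻¹' {(u : _ ⧸ _)} =
      q.toClass.values := by
  have key : ∀ v : (R ⧸ Ideal.span {Δ})ˣ,
      u⁻¹ * v ∈ principalValues π n hπ ↔ u * v ∈ principalValues π n hπ := fun v => by
    rw [← Subgroup.mul_mem_cancel_left _ (sq_mem_principalValues hπ u)]
    congr! 1
    group
  ext v
  rw [Set.mem_preimage, Set.mem_singleton_iff, eq_comm, QuotientGroup.eq, key,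
    PrimForm.mem_values_toClass]
  refine (PrimForm.mem_values_toClass _ _).trans (exists_congr fun e => ?_)
  have hue : ∀ {z : R ⧸ Ideal.span {Δ}}, (v : R ⧸ Ideal.span {Δ}) = algebraMap R _ e * z ↔
      ((u * v : (R ⧸ Ideal.span {Δ})ˣ) : R ⧸ Ideal.span {Δ}) =
        algebraMap R _ e * (algebraMap R _ q.1.a * z) := fun {z} => by
    rw [Units.val_mul, ← hu, mul_left_comm, u.mul_right_inj]
  constructor
  · rintro ⟨X, y, h⟩
    refine ⟨(u⁻¹ : (R ⧸ Ideal.span {Δ})ˣ) * (X + algebraMap R _ t * y), y, ?_⟩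
    rw [hue, q.1.a_mul_eval ht hac, ← hu, u.mul_inv_cancel_left, add_sub_cancel_right]
    exact h
  · rintro ⟨x, y, h⟩
    refine ⟨algebraMap R _ q.1.a * x - algebraMap R _ t * y, y, ?_⟩
    rw [hue, q.1.a_mul_eval ht hac] at h
    exact h

end ValuesCoset

/-! ### Modules attached to forms. -/

section Models

open QuadraticAlgebra

variable {R : Type*} [CommRing R] {π n : R}

/-- `M` is the module attached to the form `q`: it has an `R`-basis in which `ω` acts in the same
way as it does on the basis `a, ω + t` of the ideal `⟨ω + t, a⟩`, where `t = (π - b)/2`. -/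
def IsModel (q : BinForm R) (M : Type*) [AddCommGroup M] [Module R M] [Module (QuadAlg π n) M] :
    Prop :=
  ∃ (e : Module.Basis (Fin 2) R M) (t : R), 2 * t = π - q.b ∧
    (omega : QuadAlg π n) • e 0 = -t • e 0 + q.a • e 1 ∧
    (omega : QuadAlg π n) • e 1 = -q.c • e 0 + (t - π) • e 1

variable {M M' : Type*} [AddCommGroup M] [Module R M] [Module (QuadAlg π n) M]
  [IsScalarTower R (QuadAlg π n) M] [AddCommGroup M'] [Module R M'] [Module (QuadAlg π n) M']
  [IsScalarTower R (QuadAlg π n) M']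

theorem QuadAlg.smul_eq (s : QuadAlg π n) (m : M) :
    s • m = s.re • m + s.im • (omega : QuadAlg π n) • m := by
  have h : s = s.re • (1 : QuadAlg π n) + s.im • (omega : QuadAlg π n) := by
    ext <;> simp
  conv_lhs => rw [h, add_smul, smul_assoc, smul_assoc, one_smul]

/-- An `R`-linear map which commutes with `ω` is linear over `R[ω]`. -/
def QuadAlg.linearMap (f : M →ₗ[R] M')
    (h : ∀ m, f ((omega : QuadAlg π n) • m) = (omega : QuadAlg π n) • f m) :
    M →ₗ[QuadAlg π n] M' where
  toFun := f
  map_add' := f.map_add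
  map_smul' s m := by
    rw [RingHom.id_apply, QuadAlg.smul_eq, QuadAlg.smul_eq s (f m), map_add, map_smul, map_smul, h]

theorem QuadAlg.omega_smul_smul (r : R) (m : M) :
    (omega : QuadAlg π n) • r • m = r • (omega : QuadAlg π n) • m := by
  rw [← algebraMap_smul (QuadAlg π n) r m, ← algebraMap_smul (QuadAlg π n) r (_ • m), smul_smul,
    smul_smul, mul_comm]

theorem QuadAlg.comm_omega_of_basis (e : Module.Basis (Fin 2) R M) (f : M →ₗ[R] M')
    (h : ∀ i, f ((omega : QuadAlg π n) • e i) = (omega : QuadAlg π n) • f (e i)) (m : M) :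
    f ((omega : QuadAlg π n) • m) = (omega : QuadAlg π n) • f m := by
  rw [← e.sum_repr m]
  simp only [Fin.sum_univ_two, smul_add, QuadAlg.omega_smul_smul, map_add, map_smul, h]

variable [IsDomain R]

theorem IsModel.nonempty_linearEquiv (h2 : (2 : R) ≠ 0) {q : BinForm R}
    (h : IsModel (π := π) (n := n) q M) (h' : IsModel (π := π) (n := n) q M') :
    Nonempty (M ≃ₗ[QuadAlg π n] M') := by
  obtain ⟨e, t, ht, h0, h1⟩ := h
  obtain ⟨e', t', ht', h0', h1'⟩ := h'
  obtain rfl : t = t' := mul_left_cancel₀ h2 (ht.trans ht'.symm)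
  let E : M ≃ₗ[R] M' := e.equiv e' (.refl _)
  have hE : ∀ i, E (e i) = e' i := fun i => by simp [E]
  have key := QuadAlg.comm_omega_of_basis (π := π) (n := n) e E.toLinearMap fun i => by
    fin_cases i
    · simp [h0, h0', hE]
    · simp [h1, h1', hE]
  exact ⟨.ofBijective (QuadAlg.linearMap E.toLinearMap key) E.bijective⟩

-- For `m = x e₀ + y e₁` one has `m ∧ ωm = q(x, -y) e₀ ∧ e₁`. A change of basis therefore
-- substitutes in `q` and divides by the determinant.
omit [IsDomain R] in
theorem IsModel.twist {q : BinForm R} (h : IsModel (π := π) (n := n) q M) (G : GL (Fin 2) R) :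
    IsModel (π := π) (n := n) (q.twist G) M := by
  obtain ⟨e, t, ht, h0, h1⟩ := h
  -- The sign in `q(x, -y)` conjugates `G` by `diag(1, -1)`.
  obtain ⟨N, hN₀₀, hN₀₁, hN₁₀, hN₁₁⟩ : ∃ N : GL (Fin 2) R, N 0 0 = G 0 0 ∧ N 0 1 = -G 0 1 ∧
      N 1 0 = -G 1 0 ∧ N 1 1 = G 1 1 := by
    refine BinForm.exists_gl_eq (IsUnit.of_mul_eq_one ((G.det⁻¹ : Rˣ) : R) ?_)
    linear_combination BinForm.det_inv_mul G
  let e' := e.map (Matrix.toLinOfInv e e N.mul_inv N.inv_mul)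
  have he' : ∀ i, e' i = N 0 i • e 0 + N 1 i • e 1 := fun i => by
    simp [e', Matrix.toLin_self]
  have hd := BinForm.det_inv_mul G
  have hb : q.b = π - 2 * t := by linear_combination ht
  simp only [hN₀₀, hN₀₁, hN₁₀, hN₁₁, Fin.forall_fin_two] at he'
  simp only [IsModel, BinForm.twist, hb]
  generalize ((G.det⁻¹ : Rˣ) : R) = d at *
  generalize G 0 0 = α at *
  generalize G 0 1 = β at *
  generalize G 1 0 = γ at *
  generalize G 1 1 = δ at *
  refine ⟨e', d * (t * (α * δ + β * γ) - π * (β * γ) - q.a * α * β - q.c * γ * δ), ?_, ?_, ?_⟩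
  · linear_combination π * hd
  · simp only [he', smul_add, QuadAlg.omega_smul_smul, h0, h1]
    match_scalars
    · linear_combination (α * t - γ * q.c) * hd
    · linear_combination (γ * (t - π) - α * q.a) * hd
  · simp only [he', smul_add, QuadAlg.omega_smul_smul, h0, h1]
    match_scalars
    · linear_combination (δ * q.c - β * t + β * π) * hd
    · linear_combination (β * q.a - δ * t) * hd

omit [IsDomain R] in
/-- Two bases of a module are related by a matrix, so that the forms are equivalent. -/
theorem IsModel.exists_twist_eq {q q' : BinForm R}
    (h : IsModel (π := π) (n := n) q M) (h' : IsModel (π := π) (n := n) q' M) :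
    ∃ G : GL (Fin 2) R, q' = q.twist G := by
  obtain ⟨e, t, ht, h0, h1⟩ := h
  obtain ⟨e', t', ht', h0', h1'⟩ := h'
  have hNN : e.toMatrix e' * e'.toMatrix e = 1 := e.toMatrix_mul_toMatrix_flip e'
  have hdet := congrArg Matrix.det hNN
  have hN : ∀ j, e' j = e.toMatrix e' 0 j • e 0 + e.toMatrix e' 1 j • e 1 := fun j => by
    rw [← Fin.sum_univ_two (f := fun i => e.toMatrix e' i j • e i), e.sum_toMatrix_smul_self]
  rw [Matrix.det_mul, Matrix.det_one, Matrix.det_fin_two (e.toMatrix e')] at hdet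
  generalize (e'.toMatrix e).det = d at hdet
  obtain ⟨G, hG₀₀, hG₀₁, hG₁₀, hG₁₁⟩ : ∃ G : GL (Fin 2) R, G 0 0 = e.toMatrix e' 0 0 ∧
      G 0 1 = -e.toMatrix e' 0 1 ∧ G 1 0 = -e.toMatrix e' 1 0 ∧ G 1 1 = e.toMatrix e' 1 1 := by
    refine BinForm.exists_gl_eq (IsUnit.of_mul_eq_one d ?_)
    linear_combination hdet
  rw [hN 0, hN 1] at h0' h1'
  generalize e.toMatrix e' 0 0 = α at *
  generalize e.toMatrix e' 0 1 = β at *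
  generalize e.toMatrix e' 1 0 = γ at *
  generalize e.toMatrix e' 1 1 = δ at *
  simp only [smul_add, QuadAlg.omega_smul_smul, h0, h1] at h0' h1'
  have H := fun i => congrArg (fun m => e.repr m i) h0'
  have H' := fun i => congrArg (fun m => e.repr m i) h1'
  simp [Fin.forall_fin_two] at H H'
  obtain ⟨A, B⟩ := H
  obtain ⟨A', B'⟩ := H'
  have hd := BinForm.det_inv_mul G
  refine ⟨G, ?_⟩
  have hb : q.b = π - 2 * t := by linear_combination ht
  simp only [BinForm.twist, hG₀₀, hG₀₁, hG₁₀, hG₁₁, hb] at hd ⊢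
  generalize ((G.det⁻¹ : Rˣ) : R) = d at *
  ext
  · linear_combination -q'.a * hd + d * γ * A - d * α * B
  · linear_combination ht' + (2 * t' - π) * hd - 2 * d * δ * A + 2 * d * β * B
  · linear_combination -q'.c * hd + d * δ * A' - d * β * B'

omit [IsDomain R] in
theorem IsModel.congr {q : BinForm R} (h : IsModel (π := π) (n := n) q M)
    (f : M ≃ₗ[QuadAlg π n] M') : IsModel (π := π) (n := n) q M' := by
  obtain ⟨e, t, ht, h0, h1⟩ := h
  have hs : ∀ (r : R) m, f (r • m) = r • f m := (f.restrictScalars R).map_smul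
  refine ⟨e.map (f.restrictScalars R), t, ht, ?_, ?_⟩ <;>
    simp only [Module.Basis.map_apply, LinearEquiv.restrictScalars_apply]
  · rw [← map_smul, h0, map_add, hs, hs]
  · rw [← map_smul, h1, map_add, hs, hs]

/-- The ideal `⟨ω + t, a⟩`. -/
def QuadAlg.pairIdeal (π n a t : R) : Ideal (QuadAlg π n) :=
  Ideal.span {omega + algebraMap R (QuadAlg π n) t, algebraMap R (QuadAlg π n) a}

/-- Since `ac` is the norm of `ω + t`, `ω (ω + t) = -c a + (t - π)(ω + t)`. So the `R`-span of `a`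
and `ω + t` is already an ideal, and `a ≠ 0` makes them independent. -/
theorem QuadAlg.isModel_pairIdeal (h2 : (2 : R) ≠ 0) {q : BinForm R}
    (hq : q.disc = π ^ 2 + 4 * n) (ha : q.a ≠ 0) {t : R} (ht : 2 * t = π - q.b) :
    IsModel (π := π) (n := n) q (QuadAlg.pairIdeal π n q.a t) := by
  have hac := q.mul_eq_of_disc_eq h2 hq ht
  let v : Fin 2 → QuadAlg.pairIdeal π n q.a t :=
    ![⟨algebraMap R (QuadAlg π n) q.a, Ideal.subset_span (by simp)⟩,
      ⟨omega + algebraMap R (QuadAlg π n) t, Ideal.subset_span (by simp)⟩]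
  have hv : LinearIndependent R v := by
    rw [show v = ![v 0, v 1] from rfl, LinearIndependent.pair_iff]
    intro r s h
    have h' := congrArg Subtype.val h
    have him := congrArg QuadraticAlgebra.im h'
    have hre := congrArg QuadraticAlgebra.re h'
    simp [v] at him hre
    simp_all
  have hs : ⊤ ≤ Submodule.span R (Set.range v) := by
    rintro ⟨x, hx⟩ -
    obtain ⟨r, s, rfl⟩ := Ideal.mem_span_pair.mp hx
    rw [Matrix.range_cons, Matrix.range_cons, Matrix.range_empty, Set.union_empty,
      Set.singleton_union, Submodule.mem_span_pair]
    refine ⟨-r.im * q.c + s.re - s.im * t, r.re + r.im * (t - π) + s.im * q.a, ?_⟩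
    ext
    · simp
      linear_combination -r.im * hac
    · simp
      ring
  refine ⟨Module.Basis.mk hv hs, t, ht, ?_, ?_⟩
  · simp only [Module.Basis.mk_apply]
    ext
    · simp [v]
      ring
    · simp [v]
  · simp only [Module.Basis.mk_apply]
    ext
    · simp [v]
      linear_combination hac
    · simp [v, sub_eq_add_neg]

end Models

open QuadraticAlgebra Module
open scoped TensorProduct nonZeroDivisors

/-! ### Products of the ideals `⟨ω + t, a⟩`. -/

namespace QuadAlg

variable {R : Type*} [CommRing R] {π n : R}

theorem mul_mem_pairIdeal_left (a t : R) (s : QuadAlg π n) :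
    s * algebraMap R (QuadAlg π n) a ∈ pairIdeal π n a t :=
  Ideal.mul_mem_left _ _ (Ideal.subset_span (by simp))

theorem mul_mem_pairIdeal_right (a t : R) (s : QuadAlg π n) :
    s * (omega + algebraMap R (QuadAlg π n) t) ∈ pairIdeal π n a t :=
  Ideal.mul_mem_left _ _ (Ideal.subset_span (by simp))

/-- The product contains `a₁(ω + t)` and `a₂(ω + t)`, hence `ω + t` by coprimality. Conversely `(ω +
t)² = (2t - π)(ω + t) - c a₁a₂`. -/
theorem pairIdeal_mul_pairIdeal {a₁ a₂ c t : R} (h : IsCoprime a₁ a₂)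
    (hc : a₁ * a₂ * c = t ^ 2 - π * t - n) :
    pairIdeal π n a₁ t * pairIdeal π n a₂ t = pairIdeal π n (a₁ * a₂) t := by
  refine le_antisymm ?_ ?_
  · rw [pairIdeal, pairIdeal, Ideal.span_pair_mul_span_pair, Ideal.span_le]
    rintro x (rfl | rfl | rfl | rfl)
    · have := Ideal.add_mem _
        (mul_mem_pairIdeal_right (π := π) (n := n) (a₁ * a₂) t (algebraMap R _ (2 * t - π)))
        (mul_mem_pairIdeal_left (π := π) (n := n) (a₁ * a₂) t (algebraMap R _ (-c)))
      refine SetLike.mem_coe.mpr ?_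
      convert this using 1
      ext
      · simp
        linear_combination hc
      · simp
        ring
    · rw [SetLike.mem_coe, mul_comm (omega + _)]
      exact mul_mem_pairIdeal_right (π := π) (n := n) (a₁ * a₂) t (algebraMap R _ a₂)
    · exact mul_mem_pairIdeal_right (π := π) (n := n) (a₁ * a₂) t (algebraMap R _ a₁)
    · have := mul_mem_pairIdeal_left (π := π) (n := n) (a₁ * a₂) t 1
      rwa [one_mul, map_mul] at this
  · obtain ⟨u, v, huv⟩ := h
    conv_lhs => rw [pairIdeal]
    rw [Ideal.span_le]
    have key : ∀ s r s' r' : QuadAlg π n,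
        (s * algebraMap R (QuadAlg π n) a₁ + r * (omega + algebraMap R (QuadAlg π n) t)) *
        (s' * algebraMap R (QuadAlg π n) a₂ + r' * (omega + algebraMap R (QuadAlg π n) t)) ∈
          pairIdeal π n a₁ t * pairIdeal π n a₂ t := fun s r s' r' =>
      Ideal.mul_mem_mul
        (Ideal.add_mem _ (mul_mem_pairIdeal_left _ _ _) (mul_mem_pairIdeal_right _ _ _))
        (Ideal.add_mem _ (mul_mem_pairIdeal_left _ _ _) (mul_mem_pairIdeal_right _ _ _))
    rintro x (rfl | rfl)
    · refine SetLike.mem_coe.mpr ?_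
      convert Ideal.add_mem _ (key (algebraMap R _ u) 0 0 1) (key 0 1 (algebraMap R _ v) 0) using 1
      have h' := congrArg (algebraMap R (QuadAlg π n)) huv
      simp only [map_add, map_mul, map_one] at h'
      linear_combination -(omega + algebraMap R (QuadAlg π n) t) * h'
    · refine SetLike.mem_coe.mpr ?_
      convert key 1 0 1 0 using 1
      simp

/-- The conjugate of `ω + t` is `-(ω + π - t)`, so `(ω + t)(ω + π - t) = -ac`. The product lies in
`⟨a⟩` and contains `a·a`, `a·b` (as a difference of generators) and `a·c`, hence `a`. -/
theorem pairIdeal_mul_conj {a b c t : R} (h : (⟨a, b, c⟩ : BinForm R).IsPrimitive)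
    (ht : 2 * t = π - b) (hc : a * c = t ^ 2 - π * t - n) :
    pairIdeal π n a t * pairIdeal π n a (π - t) =
      Ideal.span {algebraMap R (QuadAlg π n) a} := by
  refine le_antisymm ?_ ?_
  · rw [pairIdeal, pairIdeal, Ideal.span_pair_mul_span_pair, Ideal.span_le]
    rintro x (rfl | rfl | rfl | rfl)
    · refine Ideal.mem_span_singleton'.mpr ⟨algebraMap R _ (-c), ?_⟩
      ext
      · simp
        linear_combination -hc
      · simp
    · exact Ideal.mem_span_singleton'.mpr ⟨_, rfl⟩
    · exact Ideal.mem_span_singleton'.mpr ⟨_, mul_comm _ _⟩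
    · exact Ideal.mem_span_singleton'.mpr ⟨_, rfl⟩
  · obtain ⟨r, s, u, hrsu⟩ := (BinForm.isPrimitive_iff _).mp h
    rw [Ideal.span_singleton_le_iff_mem]
    have key : ∀ x y x' y' : QuadAlg π n,
        (x * algebraMap R (QuadAlg π n) a + y * (omega + algebraMap R (QuadAlg π n) t)) *
        (x' * algebraMap R (QuadAlg π n) a +
          y' * (omega + algebraMap R (QuadAlg π n) (π - t))) ∈
          pairIdeal π n a t * pairIdeal π n a (π - t) := fun s r s' r' =>
      Ideal.mul_mem_mul
        (Ideal.add_mem _ (mul_mem_pairIdeal_left _ _ _) (mul_mem_pairIdeal_right _ _ _))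
        (Ideal.add_mem _ (mul_mem_pairIdeal_left _ _ _) (mul_mem_pairIdeal_right _ _ _))
    convert Ideal.add_mem _ (Ideal.add_mem _ (key (algebraMap R _ r) 0 1 0)
      (Ideal.add_mem _ (key (algebraMap R _ s) 0 0 1) (key 0 (algebraMap R _ (-s)) 1 0)))
      (key 0 (algebraMap R _ (-u)) 0 1) using 1
    simp only at hrsu
    ext
    · simp
      linear_combination -a * hrsu + u * hc + a * s * ht
    · simp
      ring

end QuadAlg

/-! ### Invertible modules come from primitive forms. -/

namespace QuadAlg

variable {R : Type*} [CommRing R] {π n : R}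

section Invertible

variable {M : Type*} [AddCommGroup M] [Module R M] [Module (QuadAlg π n) M]
  [IsScalarTower R (QuadAlg π n) M] [Module.Invertible (QuadAlg π n) M]

omit [Module R M] [IsScalarTower R (QuadAlg π n) M] in
theorem eq_of_smul_eq {s s' : QuadAlg π n} (h : ∀ m : M, s • m = s' • m) : s = s' :=
  FaithfulSMul.eq_of_smul_eq_smul h

/-- The `R`-linear endomorphisms of an invertible module which commute with `ω` are the
multiplications by elements of `R[ω]`. -/
theorem exists_smul_eq (f : M →ₗ[R] M)
    (h : ∀ m, f ((omega : QuadAlg π n) • m) = (omega : QuadAlg π n) • f m) :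
    ∃ s : QuadAlg π n, ∀ m, f m = s • m := by
  obtain ⟨s, hs⟩ := (Module.Invertible.toModuleEnd_bijective (QuadAlg π n) M).2 (linearMap f h)
  exact ⟨s, fun m => (LinearMap.congr_fun hs m).symm⟩

/-- The module is faithful, so the characteristic equation of the matrix of `ω` holds in `S`;
comparison with `ω² + πω - n = 0` gives its trace and determinant, hence the discriminant. -/
theorem exists_isModel_of_basis (hΔ : π ^ 2 + 4 * n ≠ 0) [IsPrincipalIdealRing R]
    (e : Basis (Fin 2) R M) :
    ∃ q : BinForm R, q.IsPrimitive ∧ q.disc = π ^ 2 + 4 * n ∧ IsModel (π := π) (n := n) q M := by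
  have hrep : ∀ m : M, m = e.repr m 0 • e 0 + e.repr m 1 • e 1 := fun m => by
    conv_lhs => rw [← e.sum_repr m, Fin.sum_univ_two]
  have h0 := hrep ((omega : QuadAlg π n) • e 0)
  have h1 := hrep ((omega : QuadAlg π n) • e 1)
  generalize e.repr ((omega : QuadAlg π n) • e 0) 0 = p at *
  generalize e.repr ((omega : QuadAlg π n) • e 0) 1 = a at *
  generalize e.repr ((omega : QuadAlg π n) • e 1) 0 = c at *
  generalize e.repr ((omega : QuadAlg π n) • e 1) 1 = s at *
  obtain ⟨t, rfl⟩ : ∃ t, p = -t := ⟨-p, (neg_neg p).symm⟩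
  obtain ⟨c, rfl⟩ : ∃ c', c = -c' := ⟨-c, (neg_neg c).symm⟩
  have hchar : (omega : QuadAlg π n) * omega =
      algebraMap R _ (s - t) * omega + algebraMap R _ (t * s - a * c) := by
    refine eq_of_smul_eq (M := M) fun m => ?_
    rw [hrep m]
    generalize e.repr m 0 = x
    generalize e.repr m 1 = y
    simp only [add_smul, mul_smul, algebraMap_smul, smul_add, omega_smul_smul, h0, h1]
    match_scalars <;> ring
  have hre := congrArg QuadraticAlgebra.re hchar
  have him := congrArg QuadraticAlgebra.im hchar
  simp at hre him
  obtain rfl : s = t - π := by linear_combination -him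
  have hdisc : (⟨a, π - 2 * t, c⟩ : BinForm R).disc = π ^ 2 + 4 * n := by
    simp only [BinForm.disc]
    linear_combination -4 * hre
  refine ⟨⟨a, π - 2 * t, c⟩, ?_, hdisc, e, t, by ring, h0, h1⟩
  obtain ⟨g, hg⟩ := IsPrincipalIdealRing.principal (Ideal.span {a, π - 2 * t, c})
  have hdvd : ∀ x ∈ ({a, π - 2 * t, c} : Set R), g ∣ x := fun x hx =>
    Ideal.mem_span_singleton.mp (hg.le (Ideal.subset_span hx))
  obtain ⟨a', rfl⟩ := hdvd a (by simp)
  obtain ⟨b', hb'⟩ := hdvd (π - 2 * t) (by simp)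
  obtain ⟨c', rfl⟩ := hdvd c (by simp)
  have hg0 : g ≠ 0 := by
    rintro rfl
    apply hΔ
    rw [← hdisc]
    simp [BinForm.disc, hb']
  -- This is `(ω + t)/g`, for `g` a generator of `⟨a, b, c⟩`. It commutes with `ω`, so it is some `β
  -- ∈ S`; the `ω`-coordinate of `g β = ω + t` shows that `g` is a unit.
  let f : M →ₗ[R] M := e.constr R ![a' • e 1, -c' • e 0 - b' • e 1]
  have hf0 : f (e 0) = a' • e 1 := by simp [f]
  have hf1 : f (e 1) = -c' • e 0 - b' • e 1 := by simp [f]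
  have hf := comm_omega_of_basis (π := π) (n := n) e f fun i => by
    fin_cases i
    · simp only [Fin.zero_eta, h0, map_add, map_smul, hf0, hf1, omega_smul_smul, h1]
      match_scalars
      · linear_combination a' * hb'
      · ring
    · simp only [Fin.mk_one, h1, map_add, map_smul, hf0, hf1, omega_smul_smul, h0, smul_sub]
      match_scalars
      · ring
      · linear_combination c' * hb'
  obtain ⟨β, hβ⟩ := exists_smul_eq f hf
  have hgβ : algebraMap R _ g * β = omega + algebraMap R (QuadAlg π n) t := by
    refine eq_of_smul_eq (M := M) fun m => ?_
    rw [hrep m, mul_smul, ← hβ]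
    generalize e.repr m 0 = x
    generalize e.repr m 1 = y
    simp only [add_smul, algebraMap_smul, smul_add, omega_smul_smul, h0, h1, map_add, map_smul,
      hf0, hf1]
    match_scalars
    · linear_combination y * hb'
    · ring
  have hu := congrArg QuadraticAlgebra.im hgβ
  simp at hu
  rw [BinForm.IsPrimitive, hg]
  exact Ideal.span_singleton_eq_top.mpr (IsUnit.of_mul_eq_one _ hu)

end Invertible

section Algebra

variable [IsDomain R] (π n)

/-- `K[ω]`, where `K` is the field of fractions of `R`. -/
abbrev Frac (π n : R) : Type _ := FractionRing R ⊗[R] QuadAlg π n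

attribute [local instance] Algebra.TensorProduct.rightAlgebra

instance : Subsingleton (CommRing.Pic (Frac π n)) :=
  have := IsArtinianRing.of_finite (FractionRing R) (Frac π n)
  inferInstance

instance : FaithfulSMul (QuadAlg π n) (Frac π n) := by
  rw [faithfulSMul_iff_algebraMap_injective]
  exact Algebra.TensorProduct.includeRight_injective (IsFractionRing.injective R _)

theorem rank_frac : Module.rank R (Frac π n) = 2 := by
  rw [← IsLocalization.rank_eq (FractionRing R) R⁰ le_rfl, rank_baseChange, rank_eq_two]
  simp

theorem isUnit_algebraMap {a : R} (ha : a ≠ 0) :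
    IsUnit (algebraMap (QuadAlg π n) (Frac π n) (algebraMap R _ a)) := by
  rw [← IsScalarTower.algebraMap_apply, IsScalarTower.algebraMap_apply R (FractionRing R)]
  exact (IsUnit.mk0 _ (by simpa using ha)).map _

variable (M : Type*) [AddCommGroup M] [Module R M] [Module (QuadAlg π n) M]
  [IsScalarTower R (QuadAlg π n) M] [Module.Invertible (QuadAlg π n) M]

/-- `K[ω]` is Artinian, so its Picard group is trivial and every invertible `S`-module is isomorphic
to an invertible submodule of `K[ω]`. -/
theorem exists_injective_frac :
    ∃ f : M →ₗ[R] Frac π n, Function.Injective f := by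
  have hP : CommRing.Pic.mk (QuadAlg π n) M ∈ CommRing.relPic (QuadAlg π n) (Frac π n) := by
    rw [CommRing.relPic_eq_top]; trivial
  rw [← Submodule.range_unitsToPic] at hP
  obtain ⟨I, hI⟩ := hP
  obtain ⟨f⟩ := CommRing.Pic.mk_eq_iff.mp hI.symm
  let g := f ≪≫ₗ Submodule.unitsToPicEquiv I
  exact ⟨((I.1.subtype).comp g.toLinearMap).restrictScalars R,
    Subtype.val_injective.comp g.injective⟩

include π n in
theorem nonempty_basis [IsPrincipalIdealRing R] : Nonempty (Basis (Fin 2) R M) := by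
  obtain ⟨f, hf⟩ := exists_injective_frac π n M
  have : Module.Finite R M := .trans (QuadAlg π n) M
  have : IsTorsionFree R (Frac π n) := inferInstance
  have : IsTorsionFree R M := hf.moduleIsTorsionFree f (fun r m => f.map_smul r m)
  have : Free R M := inferInstance
  have hle : finrank R M ≤ 2 := by
    refine finrank_le_of_rank_le (Cardinal.lift_le.mp
      ((f.lift_rank_le_of_injective hf).trans ?_))
    simp [rank_frac]
  refine ⟨finBasisOfFinrankEq R M (le_antisymm hle ?_)⟩
  -- In rank at most 1, `ω` would act as a scalar `c ∈ R`, and faithfulness would give `ω = c`.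
  by_contra! hlt
  obtain ⟨v, hv⟩ := finrank_le_one_iff.mp (Nat.le_of_lt_succ hlt)
  obtain ⟨c, hc⟩ := hv ((omega : QuadAlg π n) • v)
  have h : (omega : QuadAlg π n) = algebraMap R _ c := by
    refine eq_of_smul_eq (M := M) fun m => ?_
    obtain ⟨r, rfl⟩ := hv m
    rw [omega_smul_smul, ← hc, algebraMap_smul, smul_comm]
  simpa using congrArg QuadraticAlgebra.im h

variable {π n} in
theorem exists_isModel [IsPrincipalIdealRing R] (hΔ : π ^ 2 + 4 * n ≠ 0) :
    ∃ q : BinForm R, q.IsPrimitive ∧ q.disc = π ^ 2 + 4 * n ∧ IsModel (π := π) (n := n) q M :=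
  exists_isModel_of_basis hΔ (nonempty_basis π n M).some

end Algebra
end QuadAlg

/-! ### Invertible ideals and their Picard classes. -/

namespace QuadAlg

variable {R : Type*} [CommRing R] [IsDomain R] {π n : R}

section Units

attribute [local instance] Algebra.TensorProduct.rightAlgebra

theorem isUnit_coeSubmodule_pairIdeal {a b c t : R} (h : (⟨a, b, c⟩ : BinForm R).IsPrimitive)
    (ht : 2 * t = π - b) (hc : a * c = t ^ 2 - π * t - n) (ha : a ≠ 0) :
    IsUnit (IsLocalization.coeSubmodule (Frac π n) (pairIdeal π n a t)) := by
  refine isUnit_of_mul_isUnit_left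
    (y := IsLocalization.coeSubmodule (Frac π n) (pairIdeal π n a (π - t))) ?_
  rw [← IsLocalization.coeSubmodule_mul, pairIdeal_mul_conj h ht hc,
    IsLocalization.coeSubmodule_span_singleton]
  exact (isUnit_algebraMap π n ha).map (Submodule.spanSingleton (QuadAlg π n))

/-- An ideal `I` is isomorphic to its image in `K[ω]`. -/
noncomputable def coeSubmoduleEquiv (I : Ideal (QuadAlg π n)) :
    I ≃ₗ[QuadAlg π n] IsLocalization.coeSubmodule (Frac π n) I :=
  Submodule.equivMapOfInjective (Algebra.linearMap (QuadAlg π n) (Frac π n))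
    (FaithfulSMul.algebraMap_injective (QuadAlg π n) (Frac π n)) I

theorem exists_pic {I : Ideal (QuadAlg π n)}
    (h : IsUnit (IsLocalization.coeSubmodule (Frac π n) I)) :
    ∃ P : CommRing.Pic (QuadAlg π n), Nonempty (P.AsModule ≃ₗ[QuadAlg π n] I) := by
  obtain ⟨u, hu⟩ := h
  exact ⟨Submodule.unitsToPic _ _ u,
    ⟨Submodule.unitsToPicEquiv u ≪≫ₗ LinearEquiv.ofEq _ _ hu ≪≫ₗ (coeSubmoduleEquiv I).symm⟩⟩

/-- The map from invertible submodules of `K[ω]` to `Pic S` is a homomorphism, so tensor products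
may be computed as products of ideals. -/
theorem pic_mul_eq {I J : Ideal (QuadAlg π n)}
    (hI : IsUnit (IsLocalization.coeSubmodule (Frac π n) I))
    (hJ : IsUnit (IsLocalization.coeSubmodule (Frac π n) J))
    {P Q S : CommRing.Pic (QuadAlg π n)} (hP : Nonempty (P.AsModule ≃ₗ[QuadAlg π n] I))
    (hQ : Nonempty (Q.AsModule ≃ₗ[QuadAlg π n] J))
    (hS : Nonempty (S.AsModule ≃ₗ[QuadAlg π n] (I * J : Ideal (QuadAlg π n)))) :
    P * Q = S := by
  obtain ⟨u, hu⟩ := hI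
  obtain ⟨v, hv⟩ := hJ
  have key : ∀ {K : Ideal (QuadAlg π n)} {P : CommRing.Pic (QuadAlg π n)}
      {w : (Submodule (QuadAlg π n) (Frac π n))ˣ},
      w = IsLocalization.coeSubmodule (Frac π n) K →
      Nonempty (P.AsModule ≃ₗ[QuadAlg π n] K) → P = Submodule.unitsToPic _ _ w := by
    rintro K P w hw ⟨f⟩
    exact CommRing.Pic.ext_iff.mpr ⟨f ≪≫ₗ coeSubmoduleEquiv K ≪≫ₗ LinearEquiv.ofEq _ _ hw.symm ≪≫ₗ
      (Submodule.unitsToPicEquiv w).symm⟩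
  rw [key hu hP, key hv hQ, ← map_mul]
  refine (key ?_ hS).symm
  rw [Units.val_mul, hu, hv, IsLocalization.coeSubmodule_mul]

end Units

noncomputable instance (P : CommRing.Pic (QuadAlg π n)) : Module R P.AsModule :=
  Module.compHom _ (algebraMap R (QuadAlg π n))

instance (P : CommRing.Pic (QuadAlg π n)) : IsScalarTower R (QuadAlg π n) P.AsModule where
  smul_assoc r s m := by
    rw [Algebra.smul_def, mul_smul]
    rfl

end QuadAlg

/-! ### The bijection with the Picard group and the composition law. -/

section Correspondence

variable {R : Type*} [CommRing R] {Δ : R} {π n : R}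

/-- `P` is the class of the modules attached to the forms in `X`. -/
def TwistedClass.Corresponds (X : TwistedClass R Δ) (P : CommRing.Pic (QuadAlg π n)) : Prop :=
  ∃ q : PrimForm R Δ, q.toClass = X ∧ IsModel (π := π) (n := n) q.1 P.AsModule

variable [IsDomain R] (h2 : (2 : R) ≠ 0) (hπ : Δ = π ^ 2 + 4 * n)

omit [IsDomain R] in
theorem PrimForm.corresponds_iff (q : PrimForm R Δ) (P : CommRing.Pic (QuadAlg π n)) :
    q.toClass.Corresponds P ↔ IsModel (π := π) (n := n) q.1 P.AsModule := by
  refine ⟨?_, fun h => ⟨q, rfl, h⟩⟩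
  rintro ⟨q', hq', h⟩
  obtain ⟨M, hM⟩ := TwistedClass.toClass_eq_toClass.mp hq'
  rw [hM]
  exact h.twist M

include h2 hπ in
theorem PrimForm.corresponds_iff_nonempty (q : PrimForm R Δ) {a t : R} (hqa : q.1.a = a)
    (ha : a ≠ 0) (ht : 2 * t = π - q.1.b) (P : CommRing.Pic (QuadAlg π n)) :
    q.toClass.Corresponds P ↔
      Nonempty (P.AsModule ≃ₗ[QuadAlg π n] QuadAlg.pairIdeal π n a t) := by
  subst hqa
  have h := QuadAlg.isModel_pairIdeal h2 (q.2.2.trans hπ) ha ht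
  rw [q.corresponds_iff]
  exact ⟨fun h' => h'.nonempty_linearEquiv h2 h, fun ⟨f⟩ => h.congr f.symm⟩

include h2 in
theorem TwistedClass.Corresponds.pic_eq {X : TwistedClass R Δ} {P Q : CommRing.Pic (QuadAlg π n)}
    (hP : X.Corresponds P) (hQ : X.Corresponds Q) : P = Q := by
  obtain ⟨q, rfl, hq⟩ := hP
  rw [q.corresponds_iff] at hQ
  exact CommRing.Pic.ext_iff.mpr (hq.nonempty_linearEquiv h2 hQ)

omit [IsDomain R] in
theorem TwistedClass.Corresponds.class_eq {X Y : TwistedClass R Δ}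
    {P : CommRing.Pic (QuadAlg π n)} (hX : X.Corresponds P) (hY : Y.Corresponds P) : X = Y := by
  obtain ⟨q, rfl, hq⟩ := hX
  obtain ⟨q', rfl, hq'⟩ := hY
  exact TwistedClass.toClass_eq_toClass.mpr (hq.exists_twist_eq hq')

variable [IsPrincipalIdealRing R]

include h2 hπ in
theorem PrimForm.exists_half (q : PrimForm R Δ) :
    ∃ t : R, 2 * t = π - q.1.b ∧ q.1.a * q.1.c = t ^ 2 - π * t - n := by
  obtain ⟨t, ht⟩ := q.1.exists_two_mul_eq_sub h2 (q.2.2.trans hπ)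
  exact ⟨t, ht, q.1.mul_eq_of_disc_eq h2 (q.2.2.trans hπ) ht⟩

include h2 hπ in
theorem TwistedClass.exists_corresponds (X : TwistedClass R Δ) :
    ∃ P : CommRing.Pic (QuadAlg π n), X.Corresponds P := by
  -- Coprimality to `1` is vacuous; only `a ≠ 0` is wanted.
  obtain ⟨q, rfl, ha, -⟩ := X.exists_rep_isCoprime one_ne_zero
  obtain ⟨t, ht, hac⟩ := q.exists_half h2 hπ
  obtain ⟨P, hP⟩ := QuadAlg.exists_pic (QuadAlg.isUnit_coeSubmodule_pairIdeal q.2.1 ht hac ha)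
  exact ⟨P, (q.corresponds_iff_nonempty h2 hπ rfl ha ht P).mpr hP⟩

include hπ in
theorem CommRing.Pic.exists_corresponds (hΔ : Δ ≠ 0) (P : CommRing.Pic (QuadAlg π n)) :
    ∃ X : TwistedClass R Δ, X.Corresponds P := by
  obtain ⟨q, hq, hd, h⟩ := QuadAlg.exists_isModel P.AsModule (hπ ▸ hΔ : π ^ 2 + 4 * n ≠ 0)
  exact ⟨PrimForm.toClass ⟨q, hq, hd.trans hπ.symm⟩, _, rfl, h⟩

include h2 hπ in
theorem exists_equiv_corresponds (hΔ : Δ ≠ 0) :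
    ∃ Φ : TwistedClass R Δ ≃ CommRing.Pic (QuadAlg π n), ∀ X : TwistedClass R Δ, X.Corresponds (Φ X) := by
  choose f hf using TwistedClass.exists_corresponds (Δ := Δ) h2 hπ
  refine ⟨.ofBijective f ⟨fun X Y h => (hf X).class_eq (h ▸ hf Y), fun P => ?_⟩, hf⟩
  obtain ⟨X, hX⟩ := P.exists_corresponds hπ hΔ
  exact ⟨X, (hf X).pic_eq h2 hX⟩

-- Every class contains a form with `a ≠ 0`, so the condition on ideals determines `Φ` on all
-- classes.
include h2 hπ in
theorem isCompositionLaw_iff (G : CommGroup (TwistedClass R Δ)) :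
    IsCompositionLaw π n G ↔ ∃ Φ : TwistedClass R Δ ≃* CommRing.Pic (QuadAlg π n),
      ∀ X : TwistedClass R Δ, X.Corresponds (Φ X) := by
  refine exists_congr fun Φ => ⟨fun h X => ?_, fun h q ha => ?_⟩
  · obtain ⟨q, rfl, ha, -⟩ := X.exists_rep_isCoprime one_ne_zero
    obtain ⟨t, ht, hI⟩ := h q ha
    exact (q.corresponds_iff_nonempty h2 hπ rfl ha ht _).mpr hI
  · obtain ⟨t, ht, -⟩ := q.exists_half h2 hπ
    exact ⟨t, ht, (q.corresponds_iff_nonempty h2 hπ rfl ha ht _).mp (h _)⟩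

include h2 hπ in
theorem existsUnique_isCompositionLaw (hΔ : Δ ≠ 0) :
    ∃! G : CommGroup (TwistedClass R Δ), IsCompositionLaw π n G := by
  obtain ⟨Φ, hΦ⟩ := exists_equiv_corresponds (Δ := Δ) h2 hπ hΔ
  refine ⟨Φ.commGroup, (isCompositionLaw_iff h2 hπ _).mpr
    ⟨letI := Φ.commGroup; Φ.mulEquiv, hΦ⟩, fun G hG => ?_⟩
  obtain ⟨Ψ, hΨ⟩ := (isCompositionLaw_iff h2 hπ G).mp hG
  have h : ∀ X, Ψ X = Φ X := fun X => (hΨ X).pic_eq h2 (hΦ X)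
  refine CommGroup.ext (funext fun X => funext fun Y => ?_)
  refine Ψ.injective ((Ψ.map_mul X Y).trans ?_)
  rw [h, h, h]
  exact (Φ.apply_symm_apply _).symm

include h2 hπ in
theorem IsCompositionLaw.principal_eq_one [G : CommGroup (TwistedClass R Δ)]
    (hG : IsCompositionLaw π n G) : (principalForm π n hπ).toClass = 1 := by
  obtain ⟨Φ, hΦ⟩ := (isCompositionLaw_iff h2 hπ G).mp hG
  refine Φ.injective (Eq.trans ?_ Φ.map_one.symm)
  rw [← CommRing.Pic.mk_eq_self (M := Φ _), CommRing.Pic.mk_eq_one_iff]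
  obtain ⟨t, ht, -⟩ := (principalForm π n hπ).exists_half h2 hπ
  obtain ⟨f⟩ := ((principalForm π n hπ).corresponds_iff_nonempty h2 hπ rfl one_ne_zero ht _).mp (hΦ _)
  refine ⟨f ≪≫ₗ LinearEquiv.ofTop _ ?_⟩
  rw [Ideal.eq_top_iff_one]
  exact Ideal.subset_span (by simp [principalForm])

include h2 hπ in
/-- Composition of concordant forms. -/
theorem IsCompositionLaw.mul_eq [G : CommGroup (TwistedClass R Δ)] (hG : IsCompositionLaw π n G)
    {q₁ q₂ q₃ : PrimForm R Δ} {a₁ a₂ b c : R} (h₁ : q₁.1 = ⟨a₁, b, a₂ * c⟩)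
    (h₂ : q₂.1 = ⟨a₂, b, a₁ * c⟩) (h₃ : q₃.1 = ⟨a₁ * a₂, b, c⟩) (ha₁ : a₁ ≠ 0) (ha₂ : a₂ ≠ 0)
    (h : IsCoprime a₁ a₂) : q₁.toClass * q₂.toClass = q₃.toClass := by
  obtain ⟨Φ, hΦ⟩ := (isCompositionLaw_iff h2 hπ G).mp hG
  obtain ⟨t, ht, hac⟩ := q₃.exists_half h2 hπ
  simp only [h₃] at ht hac
  have H₁ := (q₁.corresponds_iff_nonempty h2 hπ (by rw [h₁]) ha₁ (t := t) (by rwa [h₁]) _).mp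
    (hΦ _)
  have H₂ := (q₂.corresponds_iff_nonempty h2 hπ (by rw [h₂]) ha₂ (t := t) (by rwa [h₂]) _).mp
    (hΦ _)
  have H₃ := (q₃.corresponds_iff_nonempty h2 hπ (by rw [h₃]) (mul_ne_zero ha₁ ha₂) (t := t)
    (by rwa [h₃]) _).mp (hΦ _)
  rw [← QuadAlg.pairIdeal_mul_pairIdeal h hac] at H₃
  refine Φ.injective ((Φ.map_mul _ _).trans (QuadAlg.pic_mul_eq ?_ ?_ H₁ H₂ H₃))
  · exact QuadAlg.isUnit_coeSubmodule_pairIdeal (h₁ ▸ q₁.2.1) ht (by rw [← hac]; ring) ha₁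
  · exact QuadAlg.isUnit_coeSubmodule_pairIdeal (h₂ ▸ q₂.2.1) ht (by rw [← hac]; ring) ha₂

end Correspondence

/-! ### The genus homomorphism. -/

section Genus

variable {R : Type*} [CommRing R] {Δ : R}

theorem IsCoprime.exists_unit_quotient {a : R} (h : IsCoprime a Δ) :
    ∃ u : (R ⧸ Ideal.span {Δ})ˣ, (u : R ⧸ Ideal.span {Δ}) = algebraMap R _ a := by
  obtain ⟨r, s, hrs⟩ := h
  have hΔ : algebraMap R (R ⧸ Ideal.span {Δ}) Δ = 0 :=
    Ideal.Quotient.eq_zero_iff_mem.mpr (Ideal.mem_span_singleton_self Δ)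
  refine ⟨(IsUnit.of_mul_eq_one (algebraMap R _ r) ?_).unit, rfl⟩
  rw [mul_comm, ← map_mul, ← add_zero (algebraMap R _ _), ← mul_zero (algebraMap R _ s), ← hΔ,
    ← map_mul, ← map_add, hrs, map_one]

variable [IsDomain R] [IsPrincipalIdealRing R] {π n : R} (h2 : (2 : R) ≠ 0)
  (hπ : Δ = π ^ 2 + 4 * n)

include h2 in
theorem TwistedClass.exists_preimage_eq_values (hΔ : Δ ≠ 0) (X : TwistedClass R Δ) :
    ∃ g : (R ⧸ Ideal.span {Δ})ˣ ⧸ principalValues π n hπ,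
      (QuotientGroup.mk : (R ⧸ Ideal.span {Δ})ˣ →
        (R ⧸ Ideal.span {Δ})ˣ ⧸ principalValues π n hπ) ⁻¹' {g} = X.values := by
  obtain ⟨q, rfl, -, hq⟩ := X.exists_rep_isCoprime hΔ
  obtain ⟨t, ht, hac⟩ := q.exists_half h2 hπ
  obtain ⟨u, hu⟩ := hq.exists_unit_quotient
  exact ⟨u, q.values_toClass_eq_preimage hπ ht hac u hu⟩

include h2 in
theorem IsCompositionLaw.exists_genus_hom [G : CommGroup (TwistedClass R Δ)]
    (hG : IsCompositionLaw π n G) (hΔ : Δ ≠ 0) :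
    ∃ ψ : TwistedClass R Δ →* (R ⧸ Ideal.span {Δ})ˣ ⧸ principalValues π n hπ,
      ∀ X : TwistedClass R Δ,
        (QuotientGroup.mk : (R ⧸ Ideal.span {Δ})ˣ →
          (R ⧸ Ideal.span {Δ})ˣ ⧸ principalValues π n hπ) ⁻¹' {ψ X} = X.values := by
  choose ψ hψ using TwistedClass.exists_preimage_eq_values (Δ := Δ) h2 hπ hΔ
  have key : ∀ (q : PrimForm R Δ) (u : (R ⧸ Ideal.span {Δ})ˣ),
      (u : R ⧸ Ideal.span {Δ}) = algebraMap R _ q.1.a → ψ q.toClass = u := fun q u hu => by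
    obtain ⟨t, ht, hac⟩ := q.exists_half h2 hπ
    have h := (hψ q.toClass).trans (q.values_toClass_eq_preimage hπ ht hac u hu).symm
    have hu : u ∈ (QuotientGroup.mk : (R ⧸ Ideal.span {Δ})ˣ →
          (R ⧸ Ideal.span {Δ})ˣ ⧸ principalValues π n hπ) ⁻¹' {ψ q.toClass} := h ▸ rfl
    exact Eq.symm hu
  refine ⟨MonoidHom.mk' ψ fun X Y => ?_, hψ⟩
  obtain ⟨q₁, q₂, a₁, a₂, b, c, rfl, rfl, h₁, h₂, ha₁, ha₂, h₁₂, h₁Δ, h₂Δ⟩ :=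
    TwistedClass.exists_concordant h2 hΔ hπ X Y
  have hd : (⟨a₁ * a₂, b, c⟩ : BinForm R).disc = Δ := by
    have h := q₁.2.2
    rw [h₁] at h
    rw [← h]
    simp only [BinForm.disc]
    ring
  have hp : (⟨a₁ * a₂, b, c⟩ : BinForm R).IsPrimitive := by
    obtain ⟨r, s, t, h⟩ := (BinForm.isPrimitive_iff _).mp (h₁ ▸ q₁.2.1)
    obtain ⟨r', s', t', h'⟩ := (BinForm.isPrimitive_iff _).mp (h₂ ▸ q₂.2.1)
    -- In the Bézout identity of `q₁`, the term `r a₁` is replaced by `r a₁` times the Bézout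
    -- identity of `q₂`.
    refine (BinForm.isPrimitive_iff _).mpr ⟨r * r', r * a₁ * s' + s, t * a₂ + r * a₁ * t' * a₁, ?_⟩
    simp only at h h' ⊢
    linear_combination h + r * a₁ * h'
  obtain ⟨u₁, hu₁⟩ := h₁Δ.exists_unit_quotient
  obtain ⟨u₂, hu₂⟩ := h₂Δ.exists_unit_quotient
  obtain ⟨q₃, h₃⟩ : ∃ q₃ : PrimForm R Δ, q₃.1 = ⟨a₁ * a₂, b, c⟩ := ⟨⟨_, hp, hd⟩, rfl⟩
  rw [hG.mul_eq h2 hπ h₁ h₂ h₃ ha₁ ha₂ h₁₂, key q₁ u₁ (by rw [hu₁, h₁]),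
    key q₂ u₂ (by rw [hu₂, h₂]), key q₃ (u₁ * u₂) (by rw [Units.val_mul, hu₁, hu₂, h₃, map_mul]),
    QuotientGroup.mk_mul]

end Genus

theorem mainTheorem3 {R : Type*} [CommRing R] [IsDomain R] [IsPrincipalIdealRing R]
    (h2 : (2 : R) ≠ 0) (Δ : R) (hΔ : Δ ≠ 0) (π n : R) (hπ : Δ = π ^ 2 + 4 * n) :
    (∃! G : CommGroup (TwistedClass R Δ), IsCompositionLaw π n G) ∧
    ∀ G : CommGroup (TwistedClass R Δ), IsCompositionLaw π n G →
      (principalForm π n hπ).toClass = (1 : TwistedClass R Δ) ∧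
      ∃ ψ : TwistedClass R Δ →* (R ⧸ Ideal.span {Δ})ˣ ⧸ principalValues π n hπ,
        (∀ X : TwistedClass R Δ,
          (QuotientGroup.mk : (R ⧸ Ideal.span {Δ})ˣ →
            (R ⧸ Ideal.span {Δ})ˣ ⧸ principalValues π n hπ) ⁻¹' {ψ X} = X.values) ∧
        Subgroup.square (TwistedClass R Δ) ≤ ψ.ker ∧
        ∃! Ψ : TwistedClass R Δ ⧸ Subgroup.square (TwistedClass R Δ) →*
            (R ⧸ Ideal.span {Δ})ˣ ⧸ principalValues π n hπ,
          Ψ.comp (QuotientGroup.mk' (Subgroup.square (TwistedClass R Δ))) = ψ := by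
  refine ⟨existsUnique_isCompositionLaw h2 hπ hΔ, fun G hG => ⟨hG.principal_eq_one h2 hπ, ?_⟩⟩
  obtain ⟨ψ, hψ⟩ := hG.exists_genus_hom h2 hπ hΔ
  have hker : Subgroup.square (TwistedClass R Δ) ≤ ψ.ker := by
    intro X hX
    obtain ⟨Y, rfl⟩ := Subgroup.mem_square.mp hX
    rw [MonoidHom.mem_ker, map_mul]
    obtain ⟨u, hu⟩ := QuotientGroup.mk_surjective (ψ Y)
    rw [← hu, ← QuotientGroup.mk_mul, QuotientGroup.eq_one_iff, ← sq]
    exact sq_mem_principalValues hπ u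
  exact ⟨ψ, hψ, hker, QuotientGroup.lift _ ψ hker, QuotientGroup.lift_comp_mk' _ ψ hker,
    fun Ψ hΨ => QuotientGroup.monoidHom_ext _
      (hΨ.trans (QuotientGroup.lift_comp_mk' _ ψ hker).symm)⟩
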